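/- Let $A$ be a real $m\times n$ matrix, $b\in\mathbb{R}^m$ with $b\neq 0$, such that the matrix $(A,b)$ is totally unimodular, let $c\in\mathbb{R}^n$, and let $k$ be a positive integer. For real $\lambda\ge 0$ let $P(\lambda)$ be the linear program $\phi(\lambda)=\min\{cx : Ax=\lambda b,\ 0\le x\le 1\}$. Assume that $P(k)$ has a unique optimal solution $x^*$, and that $P(k)$ is monopoly-free, i.e. for every $j\in\{1,\dots,n\}$ there is a feasible solution $x$ of $P(k)$ with $x_j=0$. Let $J_0=\{j: x^*_j=0\}$ and $J_1=\{j: x^*_j=1\}$. The max benchmark problem is to maximize $\sum_{j\in J_1} z_j$ over all $z\in\mathbb{R}^n$ such that (1) $z_j\ge c_j$ for $j\in J_1$ and $z_j=c_j$ for $j\in J_0$; (2) $z x^*\le z\bar x$ for every $\{0,1\}$-valued feasible solution $\bar x$ of $P(k)$; (3) for every $j\in\{1,\dots,n\}$ there is a $\{0,1\}$-valued feasible solution $\bar x^j$ of $P(k)$ with $\bar x^j_j=0$ and $z x^*=z\bar x^j$. Then $P(k)$, $P(k+1)$ and the max benchmark problem all have optimal solutions, and the optimal value $\mu(k)$ of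 the max benchmark problem satisfies $$\mu(k)=k\,[\phi(k+1)-\phi(k)].$$ -/

import Mathlib

namespace TUAuction

variable {ι κ : Type*} [Fintype κ]

/-- The augmented matrix `(A, b)`. -/
def augmented (A : Matrix ι κ ℝ) (b : ι → ℝ) : Matrix ι (κ ⊕ Unit) ℝ :=
  Matrix.fromCols A (Matrix.replicateCol Unit b)

/-- Feasible solutions of the linear program `P(t)`: `A x = t b`, `0 ≤ x ≤ 1`. -/
def feasible (A : Matrix ι κ ℝ) (b : ι → ℝ) (t : ℝ) : Set (κ → ℝ) :=
  {x | A.mulVec x = t • b ∧ ∀ j, 0 ≤ x j ∧ x j ≤ 1}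

/-- A vector all of whose entries are `0` or `1`. -/
def IsBinary (x : κ → ℝ) : Prop := ∀ j, x j = 0 ∨ x j = 1

/-- The cost `c x = ∑ j, c j * x j`. -/
def cost (c x : κ → ℝ) : ℝ := ∑ j, c j * x j

/-- `x` is an optimal solution of `P(t)`: minimise `c x` over the feasible solutions. -/
def IsOptimal (A : Matrix ι κ ℝ) (b : ι → ℝ) (c : κ → ℝ) (t : ℝ) (x : κ → ℝ) : Prop :=
  x ∈ feasible A b t ∧ ∀ x' ∈ feasible A b t, cost c x ≤ cost c x'

/-- `x` is the unique optimal solution of `P(t)`. -/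
def IsUniqueOptimal (A : Matrix ι κ ℝ) (b : ι → ℝ) (c : κ → ℝ) (t : ℝ) (x : κ → ℝ) : Prop :=
  IsOptimal A b c t x ∧ ∀ x', IsOptimal A b c t x' → x' = x

/-- `P(t)` is monopoly-free: no column has to be used. -/
def MonopolyFree (A : Matrix ι κ ℝ) (b : ι → ℝ) (t : ℝ) : Prop :=
  ∀ j, ∃ x ∈ feasible A b t, x j = 0

/-- The optimal value `φ(t)` of `P(t)`. -/
noncomputable def phi (A : Matrix ι κ ℝ) (b : ι → ℝ) (c : κ → ℝ) (t : ℝ) : ℝ :=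
  sInf (cost c '' feasible A b t)

/-- The price vectors `z` admitted by the benchmark problems of `P(t)` with optimal solution `xs`:
prices of columns in `J₁ = {j | xs j = 1}` may be raised and those of columns in
`J₀ = {j | xs j = 0}` are kept; `xs` is still cheapest among the binary feasible solutions; and for
every column some equally cheap binary feasible solution avoids it. -/
structure BenchmarkFeasible (A : Matrix ι κ ℝ) (b : ι → ℝ) (c : κ → ℝ) (t : ℝ) (xs : κ → ℝ)
    (z : κ → ℝ) : Prop where
  raise : ∀ j, xs j = 1 → c j ≤ z j
  keep : ∀ j, xs j = 0 → z j = c j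
  cheapest : ∀ x ∈ feasible A b t, IsBinary x → cost z xs ≤ cost z x
  avoid : ∀ j, ∃ x ∈ feasible A b t, IsBinary x ∧ x j = 0 ∧ cost z xs = cost z x

/-- The objective of the benchmark problems: the sum of `z j` over `J₁ = {j | xs j = 1}`. -/
noncomputable def benchmarkObjective (xs z : κ → ℝ) : ℝ :=
  ∑ j ∈ Finset.univ.filter (fun j => xs j = 1), z j

/-- The values attained by the objective in the benchmark problems. -/
def benchmarkValues (A : Matrix ι κ ℝ) (b : ι → ℝ) (c : κ → ℝ) (t : ℝ) (xs : κ → ℝ) : Set ℝ :=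
  benchmarkObjective xs '' {z | BenchmarkFeasible A b c t xs z}

/-- The optimal value `μ(t)` of the max benchmark problem. -/
noncomputable def mu (A : Matrix ι κ ℝ) (b : ι → ℝ) (c : κ → ℝ) (t : ℝ) (xs : κ → ℝ) : ℝ :=
  sSup (benchmarkValues A b c t xs)

end TUAuction

namespace TUAuction

open Matrix

/-! Let `ys` be optimal for P(k+1) and α = φ(k+1) − φ(k). Upper bound: (k/(k+1)) `ys` is feasible
for P(k), so by integrality z·xs ≤ (k/(k+1)) z·ys, that is, z·xs ≤ k(z·ys − z·xs). Prices rise only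
where `xs` is 1, hence z·ys − z·xs ≤ α. Attainment: total unimodularity of (A, b) makes the polytope
in (x, t) integral, so φ is affine on [k, k+1]. With convexity, `xs` and `ys` both minimise c·x − αt
over t ≤ k+1. Farkas turns this into reduced costs r, nonnegative on J₀ and nonpositive on J₁.
Subtracting r from c on J₁ gives prices under which `xs` costs αk and is cheapest. Rounding
(k/(k+1)) `ys` yields the equally cheap solutions avoiding each column. Uniqueness makes `xs`
binary; monopoly-freeness makes P(k+1) feasible. -/

/-! ### Integrality of totally unimodular polytopes. -/

/-- If the columns of a totally unimodular matrix `N` are linearly independent, then `N v` integral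
forces `v` integral. -/
theorem integral_of_mulVec_integral {ι F : Type*} [Fintype F] [DecidableEq F]
    {N : Matrix ι F ℝ} (hN : N.IsTotallyUnimodular)
    (hinj : ∀ w, N *ᵥ w = 0 → w = 0) {v : F → ℝ}
    (hv : ∀ i, (N *ᵥ v) i ∈ (Int.castRingHom ℝ).range) (j : F) :
    v j ∈ (Int.castRingHom ℝ).range := by
  -- A basis chosen among the rows gives a square submatrix of determinant ±1, whose inverse is
  -- integral by Cramer's rule.
  obtain ⟨K, a, -, hspan, hli⟩ := exists_linearIndependent' ℝ (fun i => N i)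
  have htop : Submodule.span ℝ (Set.range (fun i => N i)) = ⊤ := by
    by_contra hne
    obtain ⟨f, hf0, hf⟩ := Submodule.exists_le_ker_of_lt_top _ (lt_top_iff_ne_top.2 hne)
    apply hf0
    have hrep : ∀ x : F → ℝ, f x = x ⬝ᵥ fun j => f (Pi.single j 1) := by
      intro x
      conv_lhs => rw [pi_eq_sum_univ' x]
      simp [dotProduct]
    have := hinj (fun j => f (Pi.single j 1)) (by
      funext i
      have : f (N i) = 0 := hf (Submodule.subset_span ⟨i, rfl⟩)
      rw [hrep] at this
      exact this)
    ext j
    simpa using congrFun this j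
  let B := Module.Basis.mk hli (by rw [hspan, htop])
  have : Fintype K := FiniteDimensional.fintypeBasisIndex B
  have hcard : Fintype.card F = Fintype.card K := by
    rw [← Module.finrank_eq_card_basis B, Module.finrank_fintype_fun_eq_card]
  let e : F ≃ K := Fintype.equivOfCardEq hcard
  let S : Matrix F F ℝ := N.submatrix (a ∘ e) id
  have hS : IsUnit S := by
    rw [← Matrix.linearIndependent_rows_iff_isUnit]
    exact hli.comp e e.injective
  have hdet0 : S.det ≠ 0 := ((Matrix.isUnit_iff_isUnit_det S).1 hS).ne_zero
  have hdet : S.det = 1 ∨ S.det = -1 := by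
    obtain ⟨s, hs⟩ := (isTotallyUnimodular_iff_fintype N).1 hN F (a ∘ e) id
    change _ = S.det at hs
    cases s <;> simp_all
  have hent : ∀ i j, ∃ z : ℤ, (z : ℝ) = S i j := by
    intro i j
    obtain ⟨s, hs⟩ := hN.apply (a (e i)) j
    exact ⟨(s : ℤ), by rw [← hs.trans (rfl : _ = S i j)]; cases s <;> simp⟩
  choose T hT using hent
  have hST : S = (Matrix.of T).map (Int.castRingHom ℝ) := by
    ext i j; simp [hT]
  have hadj : S.adjugate = (Matrix.of T).adjugate.map (Int.castRingHom ℝ) := by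
    rw [hST]; exact (RingHom.map_adjugate (Int.castRingHom ℝ) (Matrix.of T)).symm
  have hSv : S.adjugate *ᵥ (S *ᵥ v) = S.det • v := by
    rw [Matrix.mulVec_mulVec, Matrix.adjugate_mul, Matrix.smul_mulVec, Matrix.one_mulVec]
  have hmem : S.det * v j ∈ (Int.castRingHom ℝ).range := by
    have := congrFun hSv j
    rw [Pi.smul_apply, smul_eq_mul] at this
    rw [← this]
    refine Subring.sum_mem _ fun i _ => Subring.mul_mem _ ?_ (hv (a (e i)))
    rw [hadj]
    exact ⟨_, rfl⟩
  rcases hdet with h | h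
  · simpa [h] using hmem
  · rw [h, neg_one_mul] at hmem
    simpa using Subring.neg_mem _ hmem

/-- A linear functional on the polytope `{v | M v = 0, l ≤ v ≤ u}` of a totally unimodular matrix `M`
and integral bounds is bounded below by its values at integral points. -/
theorem exists_integral_dotProduct_le {ι κ : Type*} [Fintype κ]
    {M : Matrix ι κ ℝ} (hM : M.IsTotallyUnimodular) (l u : κ → ℤ) {v : κ → ℝ}
    (hv : M *ᵥ v = 0) (hlv : ∀ j, (l j : ℝ) ≤ v j) (hvu : ∀ j, v j ≤ u j) (f : κ → ℝ) :
    ∃ w : κ → ℝ, M *ᵥ w = 0 ∧ (∀ j, (l j : ℝ) ≤ w j ∧ w j ≤ u j) ∧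
      (∀ j, w j ∈ (Int.castRingHom ℝ).range) ∧ f ⬝ᵥ w ≤ f ⬝ᵥ v := by
  classical
  let Q : Set (κ → ℝ) := {x | M *ᵥ x = 0} ∩ Set.Icc (fun j => (l j : ℝ)) (fun j => (u j : ℝ))
  have hQ : IsCompact Q := by
    refine isCompact_Icc.inter_left (isClosed_eq ?_ continuous_const)
    exact Continuous.matrix_mulVec continuous_const continuous_id
  have hcont : Continuous fun x : κ → ℝ => f ⬝ᵥ x :=
    Continuous.dotProduct continuous_const continuous_id
  have hvQ : v ∈ Q := ⟨hv, hlv, hvu⟩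
  obtain ⟨q, hqQ, hq⟩ := hQ.exists_isMinOn ⟨v, hvQ⟩ hcont.continuousOn
  -- An extreme point of the optimal face is both optimal and rigid.
  let T : Set (κ → ℝ) := Q ∩ {x | f ⬝ᵥ x = f ⬝ᵥ q}
  have hT : IsCompact T := hQ.inter_right (isClosed_eq hcont continuous_const)
  obtain ⟨w, hwT, hw⟩ := hT.extremePoints_nonempty ⟨q, hqQ, rfl⟩
  refine ⟨w, hwT.1.1, fun j => ⟨hwT.1.2.1 j, hwT.1.2.2 j⟩, ?_, ?_⟩
  swap
  · rw [show f ⬝ᵥ w = f ⬝ᵥ q from hwT.2]; exact hq hvQ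
  let F := {j : κ // w j ∉ (Int.castRingHom ℝ).range}
  let N : Matrix ι F ℝ := M.submatrix id Subtype.val
  have hext : ∀ (N' : ι → κ → ℝ) (d : F → ℝ) (i : ι),
      ∑ j, N' i j * (if h : w j ∉ (Int.castRingHom ℝ).range then d ⟨j, h⟩ else 0)
        = ∑ j : F, N' i j * d j := by
    intro N' d i
    rw [← Fintype.sum_subtype_add_sum_subtype (fun j => w j ∉ (Int.castRingHom ℝ).range)]
    rw [Finset.sum_eq_zero (s := (Finset.univ : Finset {j // ¬ w j ∉ (Int.castRingHom ℝ).range})),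
      add_zero]
    · exact Finset.sum_congr rfl fun j _ => by rw [dif_pos j.2]
    · intro j _
      rw [dif_neg j.2, mul_zero]
  -- Fractional coordinates lie strictly between their integral bounds, so a kernel vector supported
  -- on them could be added and subtracted, contradicting extremality.
  have hinj : ∀ d, N *ᵥ d = 0 → d = 0 := by
    intro d hd
    let D : κ → ℝ := fun j => if h : w j ∉ (Int.castRingHom ℝ).range then d ⟨j, h⟩ else 0
    have hMD : M *ᵥ D = 0 := by
      funext i
      exact (hext M d i).trans (congrFun hd i)
    have hev : ∀ j, ∀ᶠ ε : ℝ in nhds 0, (l j : ℝ) ≤ w j + ε * D j ∧ w j + ε * D j ≤ u j := by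
      intro j
      by_cases h : w j ∉ (Int.castRingHom ℝ).range
      · have h1 : (l j : ℝ) < w j := lt_of_le_of_ne (hwT.1.2.1 j) fun h' => h ⟨l j, h'⟩
        have h2 : w j < u j := lt_of_le_of_ne (hwT.1.2.2 j) fun h' => h ⟨u j, h'.symm⟩
        have hc : Filter.Tendsto (fun ε : ℝ => w j + ε * D j) (nhds 0) (nhds (w j)) := by
          have : Continuous fun ε : ℝ => w j + ε * D j := by fun_prop
          simpa using this.tendsto 0
        filter_upwards [hc.eventually (lt_mem_nhds h1), hc.eventually (gt_mem_nhds h2)]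
          with ε h3 h4 using ⟨h3.le, h4.le⟩
      · have : D j = 0 := dif_neg h
        simp only [this, mul_zero, add_zero]
        exact Filter.Eventually.of_forall fun _ => ⟨hwT.1.2.1 j, hwT.1.2.2 j⟩
    obtain ⟨δ, hδ, hball⟩ := Metric.eventually_nhds_iff.1 (Filter.eventually_all.2 hev)
    have hmemQ : ∀ ε : ℝ, |ε| < δ → w + ε • D ∈ Q := by
      intro ε hε
      have := hball (y := ε) (by simpa using hε)
      refine ⟨?_, fun j => (this j).1, fun j => (this j).2⟩
      change M *ᵥ (w + ε • D) = 0
      rw [Matrix.mulVec_add, Matrix.mulVec_smul, hMD, show M *ᵥ w = 0 from hwT.1.1]; simp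
    have hp := hmemQ (δ / 2) (by rw [abs_of_pos (by positivity)]; linarith)
    have hn := hmemQ (-(δ / 2)) (by rw [abs_neg, abs_of_pos (by positivity)]; linarith)
    have hfw : f ⬝ᵥ w = f ⬝ᵥ q := hwT.2
    have hpf : f ⬝ᵥ q ≤ f ⬝ᵥ (w + (δ / 2) • D) := hq hp
    have hnf : f ⬝ᵥ q ≤ f ⬝ᵥ (w + (-(δ / 2)) • D) := hq hn
    rw [dotProduct_add, dotProduct_smul, smul_eq_mul] at hpf hnf
    have hz : δ / 2 * (f ⬝ᵥ D) = 0 := by linarith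
    have hpT : w + (δ / 2) • D ∈ T := ⟨hp, by
      change f ⬝ᵥ (w + (δ / 2) • D) = _
      rw [dotProduct_add, dotProduct_smul, smul_eq_mul]; linarith⟩
    have hnT : w + (-(δ / 2)) • D ∈ T := ⟨hn, by
      change f ⬝ᵥ (w + (-(δ / 2)) • D) = _
      rw [dotProduct_add, dotProduct_smul, smul_eq_mul]; linarith⟩
    have hwe := hw hpT hnT ⟨1 / 2, 1 / 2, by norm_num, by norm_num, by norm_num, by
      ext j; simp; ring⟩
    funext j
    have h1 := congrFun hwe j
    have h2 : D j = d j := dif_pos j.2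
    simp only [Pi.add_apply, Pi.smul_apply, smul_eq_mul, h2] at h1
    have h3 : δ / 2 * d j = 0 := by linarith
    simpa [hδ.ne'] using h3
  have hNv : ∀ i, (N *ᵥ fun j : F => w j) i ∈ (Int.castRingHom ℝ).range := by
    intro i
    have h0 : ∑ j, M i j * w j = 0 := congrFun hwT.1.1 i
    have h1 : (N *ᵥ fun j : F => w j) i =
        -∑ j, M i j * (if w j ∉ (Int.castRingHom ℝ).range then 0 else w j) := by
      change ∑ j : F, M i j * w j = _
      rw [← hext M (fun j => w j) i, eq_neg_iff_add_eq_zero, ← Finset.sum_add_distrib]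
      refine Eq.trans (Finset.sum_congr rfl fun j _ => ?_) h0
      split_ifs <;> ring
    rw [h1]
    refine Subring.neg_mem _ (Subring.sum_mem _ fun j _ => Subring.mul_mem _ ?_ ?_)
    · obtain ⟨s, hs⟩ := hM.apply i j
      exact ⟨(s : ℤ), by rw [← hs]; cases s <;> simp⟩
    · by_cases h : w j ∈ (Int.castRingHom ℝ).range
      · rwa [if_neg (not_not.2 h)]
      · rw [if_pos h]
        exact Subring.zero_mem _
  intro j
  by_contra hj
  exact hj (integral_of_mulVec_integral (hM.submatrix id Subtype.val) hinj hNv ⟨j, hj⟩)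

/-! ### Farkas' lemma. -/

/-- **Farkas lemma** for finitely many linear functionals. -/
theorem exists_nonneg_combination {V ι : Type*} [AddCommGroup V] [Module ℝ V] (s : Finset ι)
    (f : ι → V →ₗ[ℝ] ℝ) (g : V →ₗ[ℝ] ℝ) (h : ∀ x, (∀ i ∈ s, 0 ≤ f i x) → 0 ≤ g x) :
    ∃ r : ι → ℝ, (∀ i ∈ s, 0 ≤ r i) ∧ g = ∑ i ∈ s, r i • f i := by
  classical
  induction s using Finset.induction_on generalizing f g with
  | empty =>
    refine ⟨0, by simp, ?_⟩
    ext x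
    have h1 := h x (by simp)
    have h2 := h (-x) (by simp)
    rw [map_neg] at h2
    simp only [Finset.sum_empty, LinearMap.zero_apply]
    linarith
  | insert a s ha ih =>
    by_cases hs : ∀ x, (∀ i ∈ s, 0 ≤ f i x) → 0 ≤ g x
    · obtain ⟨r, hr, hg⟩ := ih f g hs
      refine ⟨Function.update r a 0, fun i hi => ?_, ?_⟩
      · rcases eq_or_ne i a with rfl | hne
        · simp
        · rw [Function.update_of_ne hne]
          exact hr i ((Finset.mem_insert.1 hi).resolve_left hne)
      · rw [Finset.sum_insert ha, Function.update_self, zero_smul, zero_add, hg]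
        refine Finset.sum_congr rfl fun i hi => ?_
        rw [Function.update_of_ne (ne_of_mem_of_not_mem hi ha)]
    · push Not at hs
      obtain ⟨y, hy, hgy⟩ := hs
      have hay : f a y < 0 := by
        by_contra hc
        have := h y (by
          intro i hi
          rcases Finset.mem_insert.1 hi with rfl | hi
          · exact not_lt.1 hc
          · exact hy i hi)
        linarith
      obtain ⟨x₀, hx₀, hgx₀, hax₀⟩ : ∃ x₀, (∀ i ∈ s, 0 ≤ f i x₀) ∧ g x₀ < 0 ∧ f a x₀ = -1 := by
        have hpos : 0 < (-f a y)⁻¹ := inv_pos.2 (by linarith)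
        refine ⟨(-f a y)⁻¹ • y, fun i hi => ?_, ?_, ?_⟩
        · rw [map_smul]; exact mul_nonneg hpos.le (hy i hi)
        · rw [map_smul]; exact mul_neg_of_pos_of_neg hpos hgy
        · rw [map_smul, smul_eq_mul]; field_simp [hay.ne]
      -- The map x ↦ x + f a x • x₀ projects onto the kernel of `f a`; induction applies to the
      -- functionals composed with it.
      obtain ⟨r, hr, hg⟩ := ih (fun i => f i + f i x₀ • f a) (g + g x₀ • f a) (by
        intro x hx
        have := h (x + f a x • x₀) (by
          intro i hi
          rcases Finset.mem_insert.1 hi with rfl | hi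
          · simp [hax₀]
          · have := hx i hi
            simp only [LinearMap.add_apply, LinearMap.smul_apply, smul_eq_mul] at this
            rw [map_add, map_smul, smul_eq_mul]; linarith)
        rw [map_add, map_smul, smul_eq_mul] at this
        simp only [LinearMap.add_apply, LinearMap.smul_apply, smul_eq_mul]; linarith)
      refine ⟨Function.update r a (∑ i ∈ s, r i * f i x₀ - g x₀), fun i hi => ?_, ?_⟩
      · rcases eq_or_ne i a with rfl | hne
        · rw [Function.update_self]
          have := Finset.sum_nonneg fun i hi => mul_nonneg (hr i hi) (hx₀ i hi)
          linarith
        · rw [Function.update_of_ne hne]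
          exact hr i ((Finset.mem_insert.1 hi).resolve_left hne)
      · rw [Finset.sum_insert ha, Function.update_self]
        have : ∑ i ∈ s, Function.update r a (∑ i ∈ s, r i * f i x₀ - g x₀) i • f i
            = ∑ i ∈ s, r i • f i := by
          refine Finset.sum_congr rfl fun i hi => ?_
          rw [Function.update_of_ne (ne_of_mem_of_not_mem hi ha)]
        rw [this]
        refine (eq_sub_iff_add_eq.2 hg).trans ?_
        simp only [smul_add, Finset.sum_add_distrib, smul_smul, ← Finset.sum_smul]
        module

/-! ### The programs P(t): convexity, rounding, feasibility of P(k+1). -/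

variable {ι κ : Type*} [Fintype κ] {A : Matrix ι κ ℝ} {b : ι → ℝ}

theorem cost_add (c x y : κ → ℝ) : cost c (x + y) = cost c x + cost c y :=
  dotProduct_add c x y

theorem cost_smul (c x : κ → ℝ) (a : ℝ) : cost c (a • x) = a * cost c x :=
  dotProduct_smul a c x

theorem isCompact_feasible (A : Matrix ι κ ℝ) (b : ι → ℝ) (t : ℝ) :
    IsCompact (feasible A b t) := by
  have : feasible A b t = {x | A *ᵥ x = t • b} ∩ Set.Icc 0 1 := by
    ext x; simp [feasible, Pi.le_def, forall_and]
  rw [this]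
  refine isCompact_Icc.inter_left (isClosed_eq ?_ continuous_const)
  exact Continuous.matrix_mulVec continuous_const continuous_id

theorem isLeast_phi (c : κ → ℝ) {t : ℝ} (h : (feasible A b t).Nonempty) :
    IsLeast (cost c '' feasible A b t) (phi A b c t) := by
  refine IsCompact.isLeast_sInf ((isCompact_feasible A b t).image ?_) (h.image _)
  exact Continuous.dotProduct continuous_const continuous_id

theorem combination_mem_feasible {t s : ℝ} {x y : κ → ℝ} (hx : x ∈ feasible A b t)
    (hy : y ∈ feasible A b s) {p q : ℝ} (hp : 0 ≤ p) (hq : 0 ≤ q) (hpq : p + q ≤ 1) :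
    p • x + q • y ∈ feasible A b (p * t + q * s) := by
  refine ⟨?_, fun j => ?_⟩
  · rw [Matrix.mulVec_add, Matrix.mulVec_smul, Matrix.mulVec_smul, hx.1, hy.1, add_smul, mul_smul,
      mul_smul]
  · have h1 := mul_nonneg hp (hx.2 j).1
    have h2 := mul_nonneg hq (hy.2 j).1
    have h3 := mul_le_mul_of_nonneg_left (hx.2 j).2 hp
    have h4 := mul_le_mul_of_nonneg_left (hy.2 j).2 hq
    simp only [Pi.add_apply, Pi.smul_apply, smul_eq_mul]
    constructor <;> linarith

theorem smul_mem_feasible {t : ℝ} {x : κ → ℝ} (hx : x ∈ feasible A b t) {p : ℝ} (hp : 0 ≤ p)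
    (hp1 : p ≤ 1) : p • x ∈ feasible A b (p * t) := by
  simpa using combination_mem_feasible hx hx hp le_rfl (by simpa using hp1)

/-- The vector (x, −t) lies in the kernel of (A, b), so integrality applies with t as an extra
variable. Taking p = q = k rounds inside P(k); p = k, q = k + 1 compares consecutive programs. -/
theorem exists_binary_cost_le (hTU : (augmented A b).IsTotallyUnimodular) {t : ℝ} {x : κ → ℝ}
    (hx : x ∈ feasible A b t) {p q : ℤ} (hp : (p : ℝ) ≤ t) (hq : t ≤ q) (c : κ → ℝ) (α : ℝ) :
    ∃ (s : ℤ) (y : κ → ℝ), p ≤ s ∧ s ≤ q ∧ y ∈ feasible A b s ∧ IsBinary y ∧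
      (∀ j, x j = 0 → y j = 0) ∧ cost c y - α * s ≤ cost c x - α * t := by
  classical
  have hmul : ∀ w : κ ⊕ Unit → ℝ, augmented A b *ᵥ w = A *ᵥ (w ∘ Sum.inl) + w (Sum.inr ()) • b := by
    intro w
    ext i
    simp [augmented, Matrix.mulVec, dotProduct, Fintype.sum_sum_type, mul_comm]
  -- The last coordinate is −t, hence the bounds −q and −p. Upper bound 0 where x vanishes preserves
  -- the zeros.
  obtain ⟨w, hw, hbox, hint, hle⟩ := exists_integral_dotProduct_le hTU
    (Sum.elim (fun _ => 0) (fun _ => -q)) (Sum.elim (fun j => if x j = 0 then 0 else 1) (fun _ => -p))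
    (v := Sum.elim x (fun _ => -t)) (by
      rw [hmul]
      change A *ᵥ x + (-t) • b = 0
      rw [hx.1]; simp)
    (by
      rintro (j | j)
      · simpa using (hx.2 j).1
      · simpa using hq)
    (by
      rintro (j | j)
      · by_cases h : x j = 0
        · simp [h]
        · simpa [h] using (hx.2 j).2
      · simpa using hp)
    (Sum.elim c (fun _ => α))
  obtain ⟨s', hs'⟩ := hint (Sum.inr ())
  have hs : ((-s' : ℤ) : ℝ) = -w (Sum.inr ()) := by rw [← hs']; simp
  have h0 := hbox (Sum.inr ())
  simp only [Sum.elim_inr] at h0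
  have hbin : IsBinary (w ∘ Sum.inl) := by
    intro j
    obtain ⟨z, hz⟩ := hint (Sum.inl j)
    have h := hbox (Sum.inl j)
    rw [← hz] at h
    simp only [Sum.elim_inl, eq_intCast, Int.cast_le] at h
    have h1 : z ≤ 1 := h.2.trans (by split_ifs <;> simp)
    have : z = 0 ∨ z = 1 := by omega
    rcases this with rfl | rfl
    · left; simpa using hz.symm
    · right; simpa using hz.symm
  refine ⟨-s', w ∘ Sum.inl, ?_, ?_, ⟨?_, ?_⟩, hbin, ?_, ?_⟩
  · have : (p : ℝ) ≤ (-s' : ℤ) := by rw [hs]; have := h0.2; push_cast at this; linarith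
    exact_mod_cast this
  · have : ((-s' : ℤ) : ℝ) ≤ q := by rw [hs]; have := h0.1; push_cast at this; linarith
    exact_mod_cast this
  · rw [hmul] at hw
    rw [hs, neg_smul]; exact eq_neg_of_add_eq_zero_left hw
  · intro j
    rcases hbin j with h | h <;> rw [h] <;> norm_num
  · intro j hj
    have h := hbox (Sum.inl j)
    simp only [Sum.elim_inl, hj, if_true, Int.cast_zero] at h
    exact le_antisymm h.2 h.1
  · rw [hs]
    simp only [dotProduct, Fintype.sum_sum_type, Sum.elim_inl, Sum.elim_inr, Finset.univ_unique,
      Finset.sum_singleton] at hle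
    simp only [cost, Function.comp_apply]
    change _ + α * w (Sum.inr ()) ≤ _ at hle
    linarith

theorem IsUniqueOptimal.isBinary (hTU : (augmented A b).IsTotallyUnimodular) {c : κ → ℝ} {k : ℕ}
    {xs : κ → ℝ} (hxs : IsUniqueOptimal A b c k xs) : IsBinary xs := by
  obtain ⟨s, y, hs1, hs2, hy, hbin, -, hle⟩ := exists_binary_cost_le hTU hxs.1.1
    (p := k) (q := k) (by simp) (by simp) c 0
  obtain rfl : s = k := le_antisymm hs2 hs1
  rw [Int.cast_natCast] at hy
  have : y = xs := hxs.2 y ⟨hy, fun x' hx' => by linarith [hxs.1.2 x' hx']⟩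
  exact this ▸ hbin

/-- A monopoly-free program with positive right-hand side has a feasible solution all of whose
entries are smaller than `1`. -/
theorem MonopolyFree.exists_lt_one {t : ℝ} {x₀ : κ → ℝ} (hx₀ : x₀ ∈ feasible A b t)
    (hmf : MonopolyFree A b t) : ∃ x ∈ feasible A b t, ∀ j, x j < 1 := by
  classical
  choose y hy hy0 using hmf
  suffices h : ∀ s : Finset κ, ∃ x ∈ feasible A b t, ∀ j ∈ s, x j < 1 by
    simpa using h Finset.univ
  intro s
  induction s using Finset.induction_on with
  | empty => exact ⟨x₀, hx₀, by simp⟩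
  | insert a s ha ih =>
    obtain ⟨x, hx, hlt⟩ := ih
    refine ⟨(1 / 2 : ℝ) • x + (1 / 2 : ℝ) • y a, ?_, fun j hj => ?_⟩
    · have := combination_mem_feasible hx (hy a) (p := 1 / 2) (q := 1 / 2) (by norm_num)
        (by norm_num) (by norm_num)
      rwa [show (1 / 2 * t + 1 / 2 * t : ℝ) = t by ring] at this
    · simp only [Pi.add_apply, Pi.smul_apply, smul_eq_mul]
      rcases Finset.mem_insert.1 hj with rfl | hj
      · have := (hx.2 j).2
        rw [hy0 j]; linarith
      · have := hlt j hj
        have := ((hy a).2 j).2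
        linarith

/-- A solution with all entries below 1 can be scaled up to a right-hand side slightly above k, then
rounded. -/
theorem MonopolyFree.feasible_succ_nonempty (hTU : (augmented A b).IsTotallyUnimodular) {k : ℕ}
    (hk : 0 < k) {x₀ : κ → ℝ} (hx₀ : x₀ ∈ feasible A b k) (hmf : MonopolyFree A b k) :
    (feasible A b ((k : ℝ) + 1)).Nonempty := by
  obtain ⟨x, hx, hlt⟩ := hmf.exists_lt_one hx₀
  have hk' : (0 : ℝ) < k := by exact_mod_cast hk
  have hev : ∀ j, ∀ᶠ ε : ℝ in nhds 0, (1 + ε) * x j < 1 := by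
    intro j
    have hc : Filter.Tendsto (fun ε : ℝ => (1 + ε) * x j) (nhds 0) (nhds (x j)) := by
      have : Continuous fun ε : ℝ => (1 + ε) * x j := by fun_prop
      simpa using this.tendsto 0
    exact hc.eventually (gt_mem_nhds (hlt j))
  have hev' : ∀ᶠ ε : ℝ in nhds 0, ε * k < 1 := by
    have : Continuous fun ε : ℝ => ε * (k : ℝ) := by fun_prop
    exact this.tendsto 0 |>.eventually (gt_mem_nhds (by simp))
  obtain ⟨δ, hδ, hball⟩ := Metric.eventually_nhds_iff.1 ((Filter.eventually_all.2 hev).and hev')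
  obtain ⟨h1, h2⟩ := hball (y := δ / 2) (by
    rw [Real.dist_eq, sub_zero, abs_of_pos (by positivity)]; linarith)
  have hfe : (1 + δ / 2) • x ∈ feasible A b ((1 + δ / 2) * k) := by
    refine ⟨by rw [Matrix.mulVec_smul, hx.1, mul_smul], fun j => ⟨?_, (h1 j).le⟩⟩
    exact mul_nonneg (by positivity) (hx.2 j).1
  have hkδ : 0 < δ / 2 * k := by positivity
  -- Cost 0 and multiplier 1 force s ≥ t > k, leaving only s = k + 1.
  obtain ⟨s, y, hs1, hs2, hy, -, -, hle⟩ := exists_binary_cost_le hTU hfe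
    (p := k) (q := k + 1) (by push_cast; linarith) (by push_cast; linarith) 0 1
  simp only [cost, Pi.zero_apply, zero_mul, Finset.sum_const_zero] at hle
  have hks : (k : ℝ) < s := by linarith
  have hks' : (k : ℤ) < s := by exact_mod_cast hks
  obtain rfl : s = k + 1 := by omega
  exact ⟨y, by simpa using hy⟩

/-! ### Lagrangian and reduced costs. -/

/-- On a totally unimodular program, optimal solutions of `P(k)` and `P(k + 1)` minimise the
Lagrangian with multiplier `φ(k + 1) - φ(k)`. -/
theorem lagrangian_le (hTU : (augmented A b).IsTotallyUnimodular) {c : κ → ℝ} {k : ℕ}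
    {xs ys : κ → ℝ} (hxs : IsOptimal A b c k xs) (hys : IsOptimal A b c ((k : ℝ) + 1) ys)
    {t : ℝ} (ht : t ≤ (k : ℝ) + 1) {x : κ → ℝ} (hx : x ∈ feasible A b t) :
    cost c xs - (cost c ys - cost c xs) * k ≤ cost c x - (cost c ys - cost c xs) * t := by
  set α := cost c ys - cost c xs with hα
  by_cases hkt : (k : ℝ) ≤ t
  · obtain ⟨s, y, hs1, hs2, hy, -, -, hle⟩ := exists_binary_cost_le hTU hx
      (p := k) (q := k + 1) (by simpa using hkt) (by simpa using ht) c α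
    refine le_trans ?_ hle
    obtain rfl | rfl : s = k ∨ s = k + 1 := by omega
    · rw [Int.cast_natCast] at hy ⊢
      linarith [hxs.2 y hy]
    · push_cast at hy ⊢
      linarith [hys.2 y hy]
  · push Not at hkt
    have hpos : 0 < (k : ℝ) + 1 - t := by linarith
    -- This weight makes k the convex combination pt + (1 − p)(k + 1).
    set p := ((k : ℝ) + 1 - t)⁻¹ with hp
    have hp0 : 0 < p := inv_pos.2 hpos
    have hp1 : p ≤ 1 := inv_le_one_of_one_le₀ (by linarith)
    have hpt : p * ((k : ℝ) + 1 - t) = 1 := inv_mul_cancel₀ hpos.ne'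
    have hmem := combination_mem_feasible hx hys.1 hp0.le (sub_nonneg.2 hp1) (by linarith)
    rw [show p * t + (1 - p) * ((k : ℝ) + 1) = k by linarith] at hmem
    have h := hxs.2 _ hmem
    rw [cost_add, cost_smul, cost_smul] at h
    have h2 : p * (cost c xs - α * k) ≤ p * (cost c x - α * t) := by
      have e1 : cost c ys = cost c xs + α := by rw [hα]; ring
      have e2 : p * t = p * k + p - 1 := by linarith
      rw [e1] at h
      have e3 : p * (cost c x - α * t) = p * cost c x - α * (p * t) := by ring
      rw [e3, e2]
      linarith
    exact le_of_mul_le_mul_left h2 hp0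

/-- Reduced costs certifying that a binary point minimises the Lagrangian. -/
theorem exists_reduced_costs {c : κ → ℝ} {k α : ℝ} {xs : κ → ℝ} (hbin : IsBinary xs)
    (hxs : xs ∈ feasible A b k)
    (hmin : ∀ t ≤ k + 1, ∀ x ∈ feasible A b t, cost c xs - α * k ≤ cost c x - α * t) :
    ∃ r : κ → ℝ, (∀ j, xs j = 0 → 0 ≤ r j) ∧ (∀ j, xs j = 1 → r j ≤ 0) ∧
      ∀ t x, A *ᵥ x = t • b → cost c x - α * t = ∑ j, r j * x j := by
  let L : (κ → ℝ) × ℝ →ₗ[ℝ] ι → ℝ :=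
    A.mulVecLin ∘ₗ LinearMap.fst ℝ _ _ - (LinearMap.snd ℝ (κ → ℝ) ℝ).smulRight b
  -- The sign is 1 where `xs` is 0 and −1 where it is 1: σ d ≥ 0 says that d points into the box.
  -- Working on the kernel of `L` absorbs the equations.
  let σ : κ → ℝ := fun j => 1 - 2 * xs j
  let f : κ → LinearMap.ker L →ₗ[ℝ] ℝ := fun j =>
    σ j • (LinearMap.proj j ∘ₗ LinearMap.fst ℝ (κ → ℝ) ℝ ∘ₗ (LinearMap.ker L).subtype)
  let G : (κ → ℝ) × ℝ →ₗ[ℝ] ℝ :=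
    (∑ j, c j • LinearMap.proj j) ∘ₗ LinearMap.fst ℝ (κ → ℝ) ℝ - α • LinearMap.snd ℝ (κ → ℝ) ℝ
  have hG : ∀ x t, G (x, t) = cost c x - α * t := by
    intro x t
    simp [G, cost]
  have hL : ∀ x t, (x, t) ∈ LinearMap.ker L ↔ A *ᵥ x = t • b := by
    intro x t
    simp [L, sub_eq_zero]
  obtain ⟨r, hr, hrG⟩ := exists_nonneg_combination Finset.univ f (G ∘ₗ (LinearMap.ker L).subtype)
    (by
      rintro ⟨⟨d, δ⟩, hd⟩ hnn
      change 0 ≤ G (d, δ)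
      rw [hG]
      rw [hL] at hd
      have hnn' : ∀ j, 0 ≤ (1 - 2 * xs j) * d j := fun j => hnn j (Finset.mem_univ j)
      -- A step of length 1/C stays in the box and raises t by at most 1, within the range of
      -- `hmin`.
      set C := ∑ j, |d j| + |δ| + 1 with hC
      have hsum : 0 ≤ ∑ j, |d j| := Finset.sum_nonneg fun j _ => abs_nonneg _
      have hC0 : 0 < C := by have := abs_nonneg δ; linarith
      have hdj : ∀ j, C⁻¹ * |d j| ≤ 1 := by
        intro j
        rw [inv_mul_le_iff₀ hC0]
        have : |d j| ≤ ∑ i, |d i| :=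
          Finset.single_le_sum (f := fun j => |d j|) (fun i _ => abs_nonneg (d i))
            (Finset.mem_univ j)
        have := abs_nonneg δ
        linarith
      have hδ : C⁻¹ * δ ≤ 1 := by
        rw [inv_mul_le_iff₀ hC0]
        have := le_abs_self δ
        linarith
      have hi : 0 < C⁻¹ := inv_pos.2 hC0
      have hmem : xs + C⁻¹ • d ∈ feasible A b (k + C⁻¹ * δ) := by
        refine ⟨?_, fun j => ?_⟩
        · rw [Matrix.mulVec_add, Matrix.mulVec_smul, hxs.1, hd, add_smul, mul_smul]
        · simp only [Pi.add_apply, Pi.smul_apply, smul_eq_mul]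
          have h1 := hnn' j
          have h2 := hdj j
          rcases hbin j with h | h
          · rw [h] at h1 ⊢
            have h3 : 0 ≤ d j := by linarith
            rw [abs_of_nonneg h3] at h2
            have := mul_nonneg hi.le h3
            constructor <;> linarith
          · rw [h] at h1 ⊢
            have h3 : d j ≤ 0 := by linarith
            rw [abs_of_nonpos h3] at h2
            have := mul_nonneg hi.le (neg_nonneg.2 h3)
            constructor <;> linarith
      have h := hmin _ (by linarith) _ hmem
      rw [cost_add, cost_smul] at h
      have h' : 0 ≤ C⁻¹ * (cost c d - α * δ) := by linarith
      exact nonneg_of_mul_nonneg_right h' hi)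
  refine ⟨fun j => r j * σ j, fun j hj => ?_, fun j hj => ?_, fun t x hx => ?_⟩
  · have := hr j (Finset.mem_univ j)
    simpa [σ, hj] using this
  · have := hr j (Finset.mem_univ j)
    simp only [σ, hj]; linarith
  · have := LinearMap.congr_fun hrG ⟨(x, t), (hL x t).2 hx⟩
    change G (x, t) = _ at this
    rw [← hG, this]
    simp [f, mul_assoc]

/-! ### Upper bound and attainment for the benchmark. -/

theorem benchmarkObjective_eq_cost {xs : κ → ℝ} (hbin : IsBinary xs) (z : κ → ℝ) :
    benchmarkObjective xs z = cost z xs := by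
  rw [benchmarkObjective, cost, Finset.sum_filter]
  refine Finset.sum_congr rfl fun j _ => ?_
  rcases hbin j with h | h <;> simp [h]

theorem benchmarkObjective_le (hTU : (augmented A b).IsTotallyUnimodular) {c : κ → ℝ} {k : ℕ}
    {xs ys z : κ → ℝ} (hbin : IsBinary xs) (hys : ys ∈ feasible A b ((k : ℝ) + 1))
    (hz : BenchmarkFeasible A b c k xs z) :
    benchmarkObjective xs z ≤ k * (cost c ys - cost c xs) := by
  have hk1 : (0 : ℝ) < k + 1 := by positivity
  have hmem := smul_mem_feasible hys (p := (k : ℝ) / (k + 1)) (by positivity)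
    (by rw [div_le_one hk1]; linarith)
  rw [div_mul_cancel₀ _ hk1.ne'] at hmem
  obtain ⟨s, y, hs1, hs2, hy, hybin, -, hle⟩ := exists_binary_cost_le hTU hmem
    (p := k) (q := k) (by simp) (by simp) z 0
  obtain rfl : s = k := le_antisymm hs2 hs1
  rw [Int.cast_natCast] at hy
  have h1 := hz.cheapest y hy hybin
  rw [cost_smul] at hle
  have h2 : cost z xs ≤ k / (k + 1) * cost z ys := by linarith
  rw [div_mul_eq_mul_div, le_div_iff₀ hk1] at h2
  -- Where a price rises, `xs` is 1 and `ys` is at most 1, so the rise adds no less to the cost of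
  -- `xs`.
  have h3 : cost z ys - cost z xs ≤ cost c ys - cost c xs := by
    simp only [cost, ← Finset.sum_sub_distrib]
    refine Finset.sum_le_sum fun j _ => ?_
    rcases hbin j with h | h
    · rw [hz.keep j h]
    · have := mul_nonneg (sub_nonneg.2 (hz.raise j h)) (sub_nonneg.2 (hys.2 j).2)
      rw [h]; linarith
  rw [benchmarkObjective_eq_cost hbin]
  have := mul_le_mul_of_nonneg_left h3 (Nat.cast_nonneg (α := ℝ) k)
  linarith

theorem exists_benchmarkFeasible (hTU : (augmented A b).IsTotallyUnimodular) {c : κ → ℝ} {k : ℕ}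
    {xs ys : κ → ℝ} (hbin : IsBinary xs) (hxs : IsOptimal A b c k xs)
    (hys : IsOptimal A b c ((k : ℝ) + 1) ys) :
    ∃ z, BenchmarkFeasible A b c k xs z ∧
      benchmarkObjective xs z = k * (cost c ys - cost c xs) := by
  classical
  have hk1 : (0 : ℝ) < k + 1 := by positivity
  set α := cost c ys - cost c xs with hα
  obtain ⟨r, hr0, hr1, hr⟩ := exists_reduced_costs hbin hxs.1
    fun t ht x hx => lagrangian_le hTU hxs hys ht hx
  rw [← hα] at hr
  have hterm : ∀ j, r j * xs j ≤ r j * ys j := by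
    intro j
    rcases hbin j with h | h
    · rw [h, mul_zero]; exact mul_nonneg (hr0 j h) (hys.1.2 j).1
    · have := mul_nonneg (neg_nonneg.2 (hr1 j h)) (sub_nonneg.2 (hys.1.2 j).2)
      rw [h]; linarith
  -- Complementary slackness: `xs` and `ys` have equal Lagrangian value.
  have hcs : ∀ j, xs j = 0 → r j * ys j = 0 := by
    have h1 := hr _ _ hxs.1.1
    have h2 := hr _ _ hys.1.1
    have hsum : ∑ j, r j * xs j = ∑ j, r j * ys j := by rw [← h1, ← h2, hα]; ring
    intro j hj
    have := (Finset.sum_eq_sum_iff_of_le fun j _ => hterm j).1 hsum j (Finset.mem_univ j)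
    rw [← this, hj, mul_zero]
  -- This makes the reduced costs on J₁ zero.
  let z : κ → ℝ := fun j => if xs j = 1 then c j - r j else c j
  have hz : ∀ x ∈ feasible A b (k : ℝ),
      cost z x = α * k + ∑ j, (if xs j = 1 then 0 else r j * x j) := by
    intro x hx
    have h : cost c x = α * k + ∑ j, r j * x j := by linarith [hr _ _ hx.1]
    have h2 : cost z x = cost c x - ∑ j, (if xs j = 1 then r j * x j else 0) := by
      simp only [cost, ← Finset.sum_sub_distrib, z]
      refine Finset.sum_congr rfl fun j _ => ?_
      split_ifs <;> ring
    rw [h2, h, add_sub_assoc, ← Finset.sum_sub_distrib]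
    congr 1
    refine Finset.sum_congr rfl fun j _ => ?_
    split_ifs <;> ring
  have hzxs : cost z xs = α * k := by
    rw [hz xs hxs.1, Finset.sum_eq_zero, add_zero]
    intro j _
    rcases hbin j with h | h <;> simp [h]
  refine ⟨z, ⟨fun j hj => ?_, fun j hj => ?_, fun x hx _ => ?_, fun j => ?_⟩, ?_⟩
  · have := hr1 j hj
    simp only [z, hj, if_true]; linarith
  · simp [z, hj]
  · rw [hz x hx, hzxs, le_add_iff_nonneg_right]
    refine Finset.sum_nonneg fun j _ => ?_
    rcases hbin j with h | h
    · simpa [h] using mul_nonneg (hr0 j h) (hx.2 j).1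
    · simp [h]
  -- All entries of the scaled `ys` are below 1; rounding it with the j-th coordinate as cost forces
  -- y j = 0.
  · have hmem := smul_mem_feasible hys.1 (p := (k : ℝ) / (k + 1)) (by positivity)
      (by rw [div_le_one hk1]; linarith)
    rw [div_mul_cancel₀ _ hk1.ne'] at hmem
    obtain ⟨s, y, hs1, hs2, hy, hybin, hy0, hle⟩ := exists_binary_cost_le hTU hmem
      (p := k) (q := k) (by simp) (by simp) (Pi.single j 1) 0
    obtain rfl : s = k := le_antisymm hs2 hs1
    rw [Int.cast_natCast] at hy
    refine ⟨y, hy, hybin, ?_, ?_⟩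
    · have hlt : (k : ℝ) / (k + 1) * ys j < 1 := by
        have h1 : (k : ℝ) / (k + 1) < 1 := by rw [div_lt_one hk1]; linarith
        exact (mul_le_of_le_one_right (by positivity) (hys.1.2 j).2).trans_lt h1
      have hle' : y j ≤ (k : ℝ) / (k + 1) * ys j := by
        simpa [cost, Pi.single_apply] using hle
      rcases hybin j with h | h
      · exact h
      · linarith
    -- Rounding keeps the zeros of `ys`, so y inherits its complementary slackness on J₀.
    · rw [hz y hy, hzxs, Finset.sum_eq_zero, add_zero]
      intro i _
      rcases hbin i with h | h
      · rcases mul_eq_zero.1 (hcs i h) with h' | h'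
        · simp [h']
        · simp [hy0 i (by simp [h'])]
      · simp [h]
  · rw [benchmarkObjective_eq_cost hbin, hzxs, mul_comm]

end TUAuction

theorem theorem1 {m n : ℕ} (A : Matrix (Fin m) (Fin n) ℝ) (b : Fin m → ℝ) (c : Fin n → ℝ)
    (hTU : (TUAuction.augmented A b).IsTotallyUnimodular) (hb : b ≠ 0)
    (k : ℕ) (hk : 0 < k) (xs : Fin n → ℝ)
    (hxs : TUAuction.IsUniqueOptimal A b c (k : ℝ) xs)
    (hmf : TUAuction.MonopolyFree A b (k : ℝ)) :
    IsLeast (TUAuction.cost c '' TUAuction.feasible A b (k : ℝ)) (TUAuction.phi A b c (k : ℝ)) ∧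
    IsLeast (TUAuction.cost c '' TUAuction.feasible A b ((k : ℝ) + 1))
      (TUAuction.phi A b c ((k : ℝ) + 1)) ∧
    IsGreatest (TUAuction.benchmarkValues A b c (k : ℝ) xs) (TUAuction.mu A b c (k : ℝ) xs) ∧
    TUAuction.mu A b c (k : ℝ) xs =
      (k : ℝ) * (TUAuction.phi A b c ((k : ℝ) + 1) - TUAuction.phi A b c (k : ℝ)) := by
  open TUAuction in
  have hbin := hxs.isBinary hTU
  have hne := hmf.feasible_succ_nonempty hTU hk hxs.1.1
  have h0 := isLeast_phi c ⟨xs, hxs.1.1⟩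
  have h1 := isLeast_phi c hne
  have hphi : phi A b c k = cost c xs :=
    h0.unique ⟨⟨xs, hxs.1.1, rfl⟩, by rintro _ ⟨x, hx, rfl⟩; exact hxs.1.2 x hx⟩
  obtain ⟨ys, hys, hysphi⟩ := h1.1
  have hopt : IsOptimal A b c ((k : ℝ) + 1) ys :=
    ⟨hys, fun x hx => hysphi.trans_le (h1.2 ⟨x, hx, rfl⟩)⟩
  have hg : IsGreatest (benchmarkValues A b c k xs) (k * (cost c ys - cost c xs)) := by
    obtain ⟨z, hz, hzobj⟩ := exists_benchmarkFeasible hTU hbin hxs.1 hopt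
    refine ⟨⟨z, hz, hzobj⟩, ?_⟩
    rintro _ ⟨z, hz, rfl⟩
    exact benchmarkObjective_le hTU hbin hys hz
  have hmu : mu A b c k xs = k * (cost c ys - cost c xs) := hg.csSup_eq
  exact ⟨h0, h1, hmu ▸ hg, by rw [hmu, hphi, ← hysphi]⟩
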